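/- Let $\mathcal G=\langle I,S,(A_i)_{i\in I},(u_i)_{i\in I},P,\delta\rangle$ be a Markov game with finite sets of players $I$, states $S$ and actions $A_i$, one-stage payoffs $u_i:S\times A\to\mathbb R$ ($A=\prod_i A_i$), transition probabilities $P(s'\mid s,a)$ and discount factor $\delta\in(0,1)$. Let $\Pi=\prod_i\Delta(A_i)^S$ be the set of stationary policy profiles. For $\pi\in\Pi$ and $\mu\in\Delta(S)$ let $V_i(\mu,\pi)=\mathbb E\big[\sum_{k\ge0}\delta^k u_i(s^k,a^k)\big]$, where $s^0\sim\mu$, the actions $a^k_i\sim\pi_i(s^k)$ are drawn independently across players, and $s^{k+1}\sim P(\cdot\mid s^k,a^k)$; write $V_i(s,\pi)$ when $s^0=s$. A profile $\pi$ is a (stationary) Nash equilibrium if $V_i(\mu',\pi)\ge V_i(\mu',\pi_i',\pi_{-i})$ for all $i$, all $\pi_i'\in\Delta(A_i)^S$ and all $\mu'\in\Delta(S)$. Let $$Q_i(s,a_i;\pi)=\sum_{a_{-i}}\prod_{j\ne i}\pi_j(s,a_j)\Big(u_i(s,a_i,a_{-i})+\delta\sum_{s'}P(s'\mid s,a_i,a_{-i})V_i(s',\pi)\Big),\qquad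 \mathrm{br}_i(s;\pi)=\operatorname*{arg\,max}_{p\in\Delta(A_i)}\sum_{a_i}p(a_i)Q_i(s,a_i;\pi).$$ Assume that $\mathcal G$ is a Markov potential game: $\Phi:S\times\Pi\to\mathbb R$ satisfies $\Phi(s,\pi_i',\pi_{-i})-\Phi(s,\pi)=V_i(s,\pi_i',\pi_{-i})-V_i(s,\pi)$ for all $s,i,\pi,\pi_i'$. Let $\mu\in\Delta(S)$ have full support and put $\Phi(\mu,\pi)=\sum_s\mu(s)\Phi(s,\pi)$. Let $0<\eta\le\gamma_i(s,\tau)\le\Gamma<\infty$ for all $i\in I$, $s\in S$, $\tau\ge0$ (for instance, positive constants $\gamma_i(s)$). Let $\varpi:[0,\infty)\to\Pi$ be a solution of the differential inclusion $$\frac{d}{d\tau}\varpi_i^\tau(s)\in\gamma_i(s,\tau)\big(\mathrm{br}_i(s;\varpi^\tau)-\varpi_i^\tau(s)\big)\qquad(i\in I,\ s\in S),$$ that is, $\varpi$ is locally absolutely continuous and the inclusion holds for almost every $\tau\ge0$. Let $\phi(\tau)=\max_{\pi\in\Pi}\Phi(\mu,\pi)-\Phi(\mu,\varpi^\tau)$.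 Then: 1. the maximum in the definition of $\phi$ is attained, and $\phi$ is non-increasing on $[0,\infty)$; 2. $\phi$ is differentiable at every $\tau\ge0$ at which $\varpi$ is differentiable and satisfies the inclusion, hence at almost every $\tau$ (derivatives at $\tau=0$ are from the right); 3. at every $\tau\ge0$ at which $\phi$ is differentiable, $\frac{d}{d\tau}\phi(\tau)\le0$; moreover $\frac{d}{d\tau}\phi(\tau)<0$ if $\varpi^\tau$ is not a Nash equilibrium, and $\frac{d}{d\tau}\phi(\tau)=0$ if $\varpi^\tau$ is a Nash equilibrium; 4. the set of Nash equilibria is non-empty, and the distance from $\varpi^\tau$ to it tends to $0$ as $\tau\to\infty$. -/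

import Mathlib

open MeasureTheory ProbabilityTheory Filter Topology

/-- A finite discounted Markov game with players `I`, states `S` and action sets `A i`. -/
structure MarkovGame (I S : Type*) (A : I → Type*) [Fintype S] where
  /-- one-stage payoff `u_i(s, a)` -/
  payoff : I → S → (∀ i, A i) → ℝ
  /-- `transition s a` is the law of the next state after the profile `a` is played in state `s` -/
  transition : S → (∀ i, A i) → stdSimplex ℝ S
  /-- discount factor -/
  discount : ℝ
  discount_pos : 0 < discount
  discount_lt_one : discount < 1

/-- Joint stationary Markov policies: `π i s a` is the probability that player `i` plays `a` in
state `s`. It carries the product topology (sup metric) of finitely many simplices. -/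
abbrev JointPolicy {I : Type*} (S : Type*) (A : I → Type*) [∀ i, Fintype (A i)] : Type _ :=
  ∀ i : I, S → stdSimplex ℝ (A i)

/-- What is realized in one stage of play: a state and an action profile
(with the discrete σ-algebra). -/
def Stage {I : Type*} (S : Type*) (A : I → Type*) : Type _ := S × (∀ i : I, A i)

section Stage

variable {I S : Type*} {A : I → Type*}

instance : MeasurableSpace (Stage S A) := ⊤

instance : DiscreteMeasurableSpace (Stage S A) := ⟨fun _ => trivial⟩

variable [Fintype I] [Fintype S] [∀ i, Fintype (A i)] [DecidableEq I]

instance : Fintype (Stage S A) := inferInstanceAs (Fintype (S × (∀ i : I, A i)))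

end Stage

namespace MarkovGame

noncomputable section

variable {I S : Type*} {A : I → Type*} [Fintype I] [Fintype S] [∀ i, Fintype (A i)]
  [DecidableEq I]

/-- The law of one stage: the state is drawn from `p`, and then the players draw their actions
independently from their policies in that state. -/
def stageLaw (p : stdSimplex ℝ S) (π : JointPolicy S A) : Measure (Stage S A) :=
  ∑ x : Stage S A, ENNReal.ofReal (p x.1 * ∏ i, π i x.1 (x.2 i)) • Measure.dirac x

instance stageLaw_isProbabilityMeasure (p : stdSimplex ℝ S) (π : JointPolicy S A) :
    IsProbabilityMeasure (stageLaw p π) := by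
  constructor
  have h0 : ∀ x : Stage S A, 0 ≤ p x.1 * ∏ i, π i x.1 (x.2 i) := fun x =>
    mul_nonneg (stdSimplex.zero_le p _)
      (Finset.prod_nonneg fun i _ => stdSimplex.zero_le (π i x.1) _)
  have h1 : ∑ x : Stage S A, p x.1 * ∏ i, π i x.1 (x.2 i) = 1 := by
    have h2 : ∑ x : Stage S A, p x.1 * ∏ i, π i x.1 (x.2 i)
        = ∑ x : S × (∀ i : I, A i), p x.1 * ∏ i, π i x.1 (x.2 i) := rfl
    rw [h2, Fintype.sum_prod_type]
    have h3 : ∀ s : S, ∑ a : (∀ i, A i), ∏ i, π i s (a i) = 1 := fun s => by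
      rw [← Fintype.prod_sum (fun i a => π i s a)]
      simp [stdSimplex.sum_eq_one]
    simp only [← Finset.mul_sum, h3, mul_one, stdSimplex.sum_eq_one]
  simp only [stageLaw, Measure.coe_finsetSum, Finset.sum_apply, Measure.smul_apply,
    measure_univ, smul_eq_mul, mul_one]
  rw [← ENNReal.ofReal_sum_of_nonneg fun x _ => h0 x, h1, ENNReal.ofReal_one]

variable (G : MarkovGame I S A)

/-- The law of stage `n + 1` given the history of stages `0, …, n`. -/
def stepKernel (π : JointPolicy S A) (n : ℕ) :
    Kernel ((_i : Finset.Iic n) → Stage S A) (Stage S A) :=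
  Kernel.ofFunOfCountable fun h =>
    stageLaw (G.transition (h ⟨n, Finset.mem_Iic.2 le_rfl⟩).1
      (h ⟨n, Finset.mem_Iic.2 le_rfl⟩).2) π

instance stepKernel_isMarkovKernel (π : JointPolicy S A) (n : ℕ) :
    IsMarkovKernel (G.stepKernel π n) :=
  ⟨fun _ => stageLaw_isProbabilityMeasure _ _⟩

/-- The law of the infinite play `(s⁰, a⁰), (s¹, a¹), …` when `s⁰ ∼ μ`, `aᵏ ∼ π(sᵏ)` and
`sᵏ⁺¹ ∼ P(· | sᵏ, aᵏ)`. -/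
def playLaw (μ : stdSimplex ℝ S) (π : JointPolicy S A) : Measure (ℕ → Stage S A) :=
  Kernel.trajMeasure (X := fun _ => Stage S A) (stageLaw μ π) (G.stepKernel π)

/-- `V_i(μ, π)`, the expected total discounted payoff of player `i`. -/
def value (i : I) (μ : stdSimplex ℝ S) (π : JointPolicy S A) : ℝ :=
  ∫ ω, ∑' k : ℕ, G.discount ^ k * G.payoff i (ω k).1 (ω k).2 ∂(G.playLaw μ π)

/-- `V_i(s, π)`, the value when the initial state is `s`. -/
def stateValue (i : I) (s : S) (π : JointPolicy S A) : ℝ :=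
  open Classical in G.value i (stdSimplex.vertex s) π

/-- `Φ` is a (state-dependent) potential function of the game: unilateral deviations change it
exactly as they change the deviator's value. -/
def IsPotential (Φ : S → JointPolicy S A → ℝ) : Prop :=
  ∀ (s : S) (i : I) (π : JointPolicy S A) (πi' : S → stdSimplex ℝ (A i)),
    Φ s (Function.update π i πi') - Φ s π =
      G.stateValue i s (Function.update π i πi') - G.stateValue i s π

/-- Stationary Nash equilibrium. -/
def IsNash (π : JointPolicy S A) : Prop :=
  ∀ (i : I) (πi' : S → stdSimplex ℝ (A i)) (μ : stdSimplex ℝ S),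
    G.value i μ (Function.update π i πi') ≤ G.value i μ π

variable [∀ i, DecidableEq (A i)]

/-- `Q_i(s, a_i; π)`: player `i` plays `ai` in the first stage, everything else follows `π`. The
sum over the opponents' actions is a sum over the profiles whose `i`-th entry is `ai`. -/
def qValue (i : I) (s : S) (ai : A i) (π : JointPolicy S A) : ℝ :=
  ∑ a : (∀ j, A j) with a i = ai,
    (∏ j ∈ Finset.univ.erase i, π j s (a j)) *
      (G.payoff i s a + G.discount * ∑ s', G.transition s a s' * G.stateValue i s' π)

/-- The set `br_i(s; π)` of optimal one-stage deviations of player `i` from `π` in state `s`. -/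
def bestOneStage (i : I) (s : S) (π : JointPolicy S A) : Set (stdSimplex ℝ (A i)) :=
  {p | ∀ q : stdSimplex ℝ (A i),
    ∑ ai, q ai * G.qValue i s ai π ≤ ∑ ai, p ai * G.qValue i s ai π}

/-- At time `τ ≥ 0` the path `ϖ` is differentiable (from the right if `τ = 0`) and
`(d/dτ) ϖ_i(s) ∈ γ_i(s, τ) (br_i(s; ϖ) - ϖ_i(s))` for all players `i` and states `s`. -/
def InclusionAt (γ : I → S → ℝ → ℝ) (ϖ : ℝ → JointPolicy S A) (τ : ℝ) : Prop :=
  ∀ (i : I) (s : S), ∃ b ∈ G.bestOneStage i s (ϖ τ), ∀ ai : A i,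
    HasDerivWithinAt (fun t => ϖ t i s ai) (γ i s τ * (b ai - ϖ τ i s ai)) (Set.Ici 0) τ

/-- Solutions on `[0, ∞)` of the differential inclusion: locally absolutely continuous paths that
satisfy it at almost every time. (Values of `ϖ` at negative times play no role.) -/
structure IsSolution (γ : I → S → ℝ → ℝ) (ϖ : ℝ → JointPolicy S A) : Prop where
  absCont : ∀ (i : I) (s : S) (ai : A i) (T : ℝ), 0 ≤ T →
    AbsolutelyContinuousOnInterval (fun t => ϖ t i s ai) 0 T
  inclusion : ∀ᵐ τ ∂(volume.restrict (Set.Ici (0 : ℝ))), G.InclusionAt γ ϖ τ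

end

end MarkovGame

/-- `Φ(μ, π) = ∑ₛ μ(s) Φ(s, π)`. -/
noncomputable def avgPotential {I S : Type*} {A : I → Type*} [Fintype S] [∀ i, Fintype (A i)]
    (Φ : S → JointPolicy S A → ℝ) (μ : stdSimplex ℝ S) (π : JointPolicy S A) : ℝ :=
  ∑ s, μ s * Φ s π

/-- `φ(τ) = max_π Φ(μ, π) - Φ(μ, ϖ^τ)`. -/
noncomputable def potentialGap {I S : Type*} {A : I → Type*} [Fintype S] [∀ i, Fintype (A i)]
    (Φ : S → JointPolicy S A → ℝ) (μ : stdSimplex ℝ S) (ϖ : ℝ → JointPolicy S A) (τ : ℝ) : ℝ :=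
  (⨆ π : JointPolicy S A, avgPotential Φ μ π) - avgPotential Φ μ (ϖ τ)

/-!
The averaged potential `Ψ(τ) = Φ(μ, ϖ^τ)` is a strict Lyapunov function of best-response dynamics.

The law of play reduces to finite sums: `value_eq_sum_visits` expresses `V_i(μ, π)` through the
discounted numbers of visits `visits μ π s = ∑ₖ δᵏ (μ Tᵏ)(s)`, where `T` is the transition matrix
of the states under `π`. The balance equation of the visits and the Bellman equation give the
performance difference formula `value_update_sub`:
`V_i(μ, π_i', π_{-i}) - V_i(μ, π) = ∑ₛ visits(s) ∑ₐ (π_i'(s, a) - π_i(s, a)) Q_i(s, a; π)`,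
with the visits under the deviating profile. As `visits(s) ≥ μ(s) > 0`, a profile is a Nash
equilibrium exactly if the best one-stage gains `gain i s π` all vanish, that is, if
`totalGain μ π = ∑ᵢ ∑ₛ visits(s) gain_i(s; π)` is zero (`totalGain_eq_zero_iff`).

Deviations of one player change `Φ(μ, ·)` as they change the value of that player, so switching the
players one at a time turns the exact formula into
`Φ(μ, π') - Φ(μ, π) = ∑ W(π, π') (π' - π)` with continuous `W` and `W(π, π) = visits * Q`
(`IsPotential.exists_weights`). Hence no differentiability of `Φ` or of the values is needed: `Φ` is
Lipschitz, and where the inclusion holds, `Ψ' = ∑ᵢ ∑ₛ γ_i(s) visits(s) gain_i(s)`, which lies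
between `η` and `Γ` times the total gain. The fundamental theorem of calculus for absolutely
continuous functions turns this into bounds on the increments of `Ψ`, which by continuity of the
total gain bound the derivative of `Ψ` wherever it exists
(`IsSolution.deriv_avgPotential_mem`). Convergence to the equilibria follows since `Ψ` is bounded,
solutions are Lipschitz, and the total gain is bounded below away from the compact set of
equilibria (`IsSolution.tendsto_infDist_isNash`). A maximizer of `Φ(μ, ·)` is an equilibrium.
-/

namespace MarkovGame

noncomputable section

/-! ### The law of the stages of play -/

section Stage

variable {I S : Type*} {A : I → Type*} [Fintype I] [∀ i, Fintype (A i)]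

lemma prod_policy_nonneg (π : JointPolicy S A) (s : S) (a : ∀ i, A i) :
    0 ≤ ∏ i, π i s (a i) :=
  Finset.prod_nonneg fun i _ => stdSimplex.zero_le (π i s) _

variable [DecidableEq I]

lemma sum_prod_policy (π : JointPolicy S A) (s : S) : ∑ a : (∀ i, A i), ∏ i, π i s (a i) = 1 := by
  rw [← Fintype.prod_sum (fun i a => π i s a)]
  simp [stdSimplex.sum_eq_one]

/-- The expectation of `f s a` when the profile `a` is drawn from `π` in state `s`. -/
def policyMean (π : JointPolicy S A) (f : S → (∀ i, A i) → ℝ) (s : S) : ℝ :=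
  ∑ a, (∏ i, π i s (a i)) * f s a

variable [Fintype S]

lemma integral_stageLaw (p : stdSimplex ℝ S) (π : JointPolicy S A) (f : Stage S A → ℝ) :
    ∫ x, f x ∂(stageLaw p π) = ∑ s, p s * policyMean π (fun s a => f (s, a)) s := by
  rw [stageLaw, integral_finsetSum_measure fun x _ => ?_]
  · simp only [integral_smul_measure, integral_dirac, smul_eq_mul]
    have h0 : ∀ x : Stage S A, 0 ≤ p x.1 * ∏ i, π i x.1 (x.2 i) := fun x =>
      mul_nonneg (stdSimplex.zero_le p _) (prod_policy_nonneg π _ _)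
    simp only [ENNReal.toReal_ofReal (h0 _)]
    have h2 : ∑ x : Stage S A, (p x.1 * ∏ i, π i x.1 (x.2 i)) * f x
        = ∑ x : S × (∀ i : I, A i), (p x.1 * ∏ i, π i x.1 (x.2 i)) * f x := rfl
    rw [h2, Fintype.sum_prod_type]
    simp only [policyMean, Finset.mul_sum, mul_assoc]
  · exact (integrable_dirac (by simp [enorm_lt_top])).smul_measure ENNReal.ofReal_ne_top

end Stage

section Value

variable {I S : Type*} {A : I → Type*} [Fintype I] [Fintype S] [∀ i, Fintype (A i)]
  [DecidableEq I] (G : MarkovGame I S A)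

/-- The transition matrix of the Markov chain of states under `π`. -/
def transMatrix (π : JointPolicy S A) : Matrix S S ℝ :=
  fun s s' => policyMean π (fun s a => G.transition s a s') s

lemma integrable_stage (μ : stdSimplex ℝ S) (π : JointPolicy S A) (k : ℕ) (f : Stage S A → ℝ) :
    Integrable (fun ω => f (ω k)) (G.playLaw μ π) := by
  have : IsProbabilityMeasure (G.playLaw μ π) := by unfold playLaw; infer_instance
  obtain ⟨C, hC⟩ := (Set.finite_range fun x => ‖f x‖).bddAbove
  refine Integrable.of_bound (C := C) ?_ (ae_of_all _ fun ω => hC ⟨ω k, rfl⟩)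
  exact ((measurable_of_countable f).comp (measurable_pi_apply k)).aestronglyMeasurable

/-- Conditioning on the first `k + 1` stages: the next stage is drawn from the step kernel. -/
lemma integral_stage_succ (μ : stdSimplex ℝ S) (π : JointPolicy S A) (k : ℕ)
    (f : Stage S A → ℝ) :
    ∫ ω, f (ω (k + 1)) ∂(G.playLaw μ π) =
      ∫ ω, (∑ s, G.transition (ω k).1 (ω k).2 s * policyMean π (fun s a => f (s, a)) s)
        ∂(G.playLaw μ π) := by
  have hP : IsProbabilityMeasure (G.playLaw μ π) := by unfold playLaw; infer_instance
  have h := Kernel.map_frestrictLe_trajMeasure_compProd_eq_map_trajMeasure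
    (X := fun _ => Stage S A) (μ₀ := stageLaw μ π) (κ := G.stepKernel π) (a := k)
  change (G.playLaw μ π).map (Preorder.frestrictLe k) ⊗ₘ G.stepKernel π k =
    (G.playLaw μ π).map (fun x ↦ (Preorder.frestrictLe k x, x (k + 1))) at h
  have hf : Measurable f := measurable_of_countable f
  have hm : Measurable (fun x : ℕ → Stage S A => (Preorder.frestrictLe k x, x (k + 1))) :=
    (Preorder.measurable_frestrictLe k).prodMk (measurable_pi_apply _)
  have hP' : IsProbabilityMeasure ((G.playLaw μ π).map (Preorder.frestrictLe k)) :=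
    Measure.isProbabilityMeasure_map (Preorder.measurable_frestrictLe k).aemeasurable
  have h1 : ∫ ω, f (ω (k + 1)) ∂(G.playLaw μ π) = ∫ y, f y.2 ∂((G.playLaw μ π).map
      (fun x ↦ (Preorder.frestrictLe k x, x (k + 1)))) := by
    rw [integral_map (f := fun y : (Finset.Iic k → Stage S A) × Stage S A => f y.2)
      hm.aemeasurable (hf.comp measurable_snd).aestronglyMeasurable]
  have hint : Integrable (fun y : (Finset.Iic k → Stage S A) × Stage S A => f y.2)
      ((G.playLaw μ π).map (Preorder.frestrictLe k) ⊗ₘ G.stepKernel π k) := by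
    obtain ⟨C, hC⟩ := (Set.finite_range fun x => ‖f x‖).bddAbove
    exact Integrable.of_bound (C := C) (hf.comp measurable_snd).aestronglyMeasurable
      (ae_of_all _ fun y => hC ⟨y.2, rfl⟩)
  rw [h1, ← h, Measure.integral_compProd hint, integral_map
    (Preorder.measurable_frestrictLe k).aemeasurable
    (measurable_of_countable _).aestronglyMeasurable]
  refine integral_congr_ae (ae_of_all _ fun ω => ?_)
  exact integral_stageLaw _ _ _

lemma integral_stage_zero (μ : stdSimplex ℝ S) (π : JointPolicy S A) (f : Stage S A → ℝ) :
    ∫ ω, f (ω 0) ∂(G.playLaw μ π) = ∑ s, μ s * policyMean π (fun s a => f (s, a)) s := by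
  have hf : Measurable f := measurable_of_countable f
  have h0 : (G.playLaw μ π).map (Preorder.frestrictLe 0) =
      (stageLaw μ π).map (MeasurableEquiv.piUnique
        (fun _ : Finset.Iic (0 : ℕ) => Stage S A)).symm := by
    unfold playLaw Kernel.trajMeasure
    rw [Measure.map_comp _ _ (by fun_prop), Kernel.traj_map_frestrictLe,
      Kernel.partialTraj_self, Measure.id_comp]
  have h1 : ∫ ω, f (ω 0) ∂(G.playLaw μ π) =
      ∫ y, f (y ⟨0, Finset.mem_Iic.2 le_rfl⟩)
        ∂((G.playLaw μ π).map (Preorder.frestrictLe 0)) := by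
    rw [integral_map (by fun_prop) (measurable_of_countable _).aestronglyMeasurable]
    rfl
  rw [h1, h0, integral_map (by fun_prop) (measurable_of_countable _).aestronglyMeasurable,
    ← integral_stageLaw]
  rfl

variable [DecidableEq S]

/-- The law of the state at stage `k` is `μ Tᵏ`. -/
lemma integral_stage (μ : stdSimplex ℝ S) (π : JointPolicy S A) (k : ℕ) (f : Stage S A → ℝ) :
    ∫ ω, f (ω k) ∂(G.playLaw μ π) =
      ∑ s, μ s * ∑ s', (G.transMatrix π ^ k) s s' * policyMean π (fun s a => f (s, a)) s' := by
  induction k generalizing f with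
  | zero => simp [integral_stage_zero, Matrix.one_apply]
  | succ k ih =>
    rw [integral_stage_succ, ih (fun x => ∑ s, G.transition x.1 x.2 s *
      policyMean π (fun s a => f (s, a)) s)]
    refine Finset.sum_congr rfl fun s _ => congrArg _ ?_
    simp only [pow_succ, Matrix.mul_apply, Finset.sum_mul]
    rw [Finset.sum_comm]
    refine Finset.sum_congr rfl fun t _ => ?_
    simp only [mul_assoc, ← Finset.mul_sum]
    congr 1
    simp only [transMatrix, policyMean, Finset.mul_sum, Finset.sum_mul]
    rw [Finset.sum_comm]
    refine Finset.sum_congr rfl fun s' _ => ?_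
    rw [Finset.sum_comm]
    simp only [mul_assoc]

lemma transMatrix_mem_rowStochastic (π : JointPolicy S A) :
    G.transMatrix π ∈ Matrix.rowStochastic ℝ S := by
  refine Matrix.mem_rowStochastic_iff_sum.2 ⟨fun s s' => Finset.sum_nonneg fun a _ =>
    mul_nonneg (prod_policy_nonneg π s a) (stdSimplex.zero_le _ _), fun s => ?_⟩
  simp only [transMatrix, policyMean]
  rw [Finset.sum_comm]
  simp [← Finset.mul_sum, sum_prod_policy]

lemma transMatrix_pow_nonneg (π : JointPolicy S A) (k : ℕ) (s s' : S) :
    0 ≤ (G.transMatrix π ^ k) s s' :=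
  Matrix.nonneg_of_mem_rowStochastic (pow_mem (G.transMatrix_mem_rowStochastic π) k)

lemma transMatrix_pow_le_one (π : JointPolicy S A) (k : ℕ) (s s' : S) :
    (G.transMatrix π ^ k) s s' ≤ 1 :=
  Matrix.le_one_of_mem_rowStochastic (pow_mem (G.transMatrix_mem_rowStochastic π) k)

/-! ### Discounted visits and the Bellman equation -/

/-- The expected discounted number of visits to `s'` when play starts in `s`. -/
def occupancy (π : JointPolicy S A) (s s' : S) : ℝ :=
  ∑' k : ℕ, G.discount ^ k * (G.transMatrix π ^ k) s s'

lemma norm_occupancy_term_le (π : JointPolicy S A) (s s' : S) (k : ℕ) :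
    ‖G.discount ^ k * (G.transMatrix π ^ k) s s'‖ ≤ G.discount ^ k := by
  have h0 : 0 ≤ G.discount ^ k := pow_nonneg G.discount_pos.le k
  rw [Real.norm_of_nonneg (mul_nonneg h0 (G.transMatrix_pow_nonneg π k s s'))]
  exact mul_le_of_le_one_right h0 (G.transMatrix_pow_le_one π k s s')

omit [Fintype I] [∀ i, Fintype (A i)] [DecidableEq I] [DecidableEq S] in
lemma summable_discount_pow : Summable fun k : ℕ => G.discount ^ k :=
  summable_geometric_of_lt_one G.discount_pos.le G.discount_lt_one

lemma summable_occupancy (π : JointPolicy S A) (s s' : S) :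
    Summable fun k : ℕ => G.discount ^ k * (G.transMatrix π ^ k) s s' :=
  .of_norm_bounded G.summable_discount_pow (G.norm_occupancy_term_le π s s')

/-- The resolvent equation `R = 1 + δ T R` for the occupancy matrix. -/
lemma occupancy_eq_left (π : JointPolicy S A) (s s' : S) :
    G.occupancy π s s' = (1 : Matrix S S ℝ) s s' +
      G.discount * ∑ t, G.transMatrix π s t * G.occupancy π t s' := by
  unfold occupancy
  rw [(G.summable_occupancy π s s').tsum_eq_zero_add]
  simp only [pow_zero, one_mul, ← tsum_mul_left]
  rw [← Summable.tsum_finsetSum fun t _ => (G.summable_occupancy π t s').mul_left _,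
    ← tsum_mul_left]
  congr 2 with k
  rw [pow_succ' (G.transMatrix π), Matrix.mul_apply, Finset.mul_sum, Finset.mul_sum]
  exact Finset.sum_congr rfl fun t _ => by ring

/-- The resolvent equation `R = 1 + δ R T` for the occupancy matrix. -/
lemma occupancy_eq_right (π : JointPolicy S A) (s s' : S) :
    G.occupancy π s s' = (1 : Matrix S S ℝ) s s' +
      G.discount * ∑ t, G.occupancy π s t * G.transMatrix π t s' := by
  unfold occupancy
  rw [(G.summable_occupancy π s s').tsum_eq_zero_add]
  simp only [pow_zero, one_mul, ← tsum_mul_right]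
  rw [← Summable.tsum_finsetSum fun t _ => (G.summable_occupancy π s t).mul_right _,
    ← tsum_mul_left]
  congr 2 with k
  rw [pow_succ (G.transMatrix π), Matrix.mul_apply, Finset.mul_sum, Finset.mul_sum]
  exact Finset.sum_congr rfl fun t _ => by ring

lemma occupancy_nonneg (π : JointPolicy S A) (s s' : S) : 0 ≤ G.occupancy π s s' :=
  tsum_nonneg fun k => mul_nonneg (pow_nonneg G.discount_pos.le k)
    (G.transMatrix_pow_nonneg π k s s')

/-- The expected discounted number of visits to `s'` when the initial state is drawn from `μ`. -/
def visits (μ : stdSimplex ℝ S) (π : JointPolicy S A) (s' : S) : ℝ :=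
  ∑ s, μ s * G.occupancy π s s'

lemma visits_nonneg (μ : stdSimplex ℝ S) (π : JointPolicy S A) (s : S) :
    0 ≤ G.visits μ π s :=
  Finset.sum_nonneg fun t _ => mul_nonneg (stdSimplex.zero_le μ t) (G.occupancy_nonneg π t s)

/-- The balance equation of the discounted state distribution. -/
lemma visits_eq (μ : stdSimplex ℝ S) (π : JointPolicy S A) (s : S) :
    G.visits μ π s = μ s + G.discount * ∑ t, G.visits μ π t * G.transMatrix π t s := by
  unfold visits
  simp_rw [fun t => G.occupancy_eq_right π t s, mul_add, Finset.sum_add_distrib]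
  congr 1
  · simp [Matrix.one_apply]
  · simp only [Finset.mul_sum, Finset.sum_mul]
    rw [Finset.sum_comm]
    exact Finset.sum_congr rfl fun _ _ => Finset.sum_congr rfl fun _ _ => by ring

/-- The initial stage counts as a visit. -/
lemma le_visits (μ : stdSimplex ℝ S) (π : JointPolicy S A) (s : S) : μ s ≤ G.visits μ π s := by
  rw [visits_eq]
  exact le_add_of_nonneg_right (mul_nonneg G.discount_pos.le (Finset.sum_nonneg fun t _ =>
    mul_nonneg (G.visits_nonneg μ π t)
      (Matrix.nonneg_of_mem_rowStochastic (G.transMatrix_mem_rowStochastic π))))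

/-- The value is the mean payoff in each state, weighted by the discounted number of visits. -/
lemma value_eq_sum_visits (i : I) (μ : stdSimplex ℝ S) (π : JointPolicy S A) :
    G.value i μ π = ∑ s, G.visits μ π s * policyMean π (G.payoff i) s := by
  have hP : IsProbabilityMeasure (G.playLaw μ π) := by unfold playLaw; infer_instance
  obtain ⟨C, hC⟩ := (Set.finite_range fun x : Stage S A => ‖G.payoff i x.1 x.2‖).bddAbove
  have hint : ∀ k : ℕ, Integrable (fun ω : ℕ → Stage S A =>
      G.discount ^ k * G.payoff i (ω k).1 (ω k).2) (G.playLaw μ π) := fun k =>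
    (G.integrable_stage μ π k fun x => G.payoff i x.1 x.2).const_mul _
  have hsum : Summable fun k : ℕ => ∫ ω : ℕ → Stage S A,
      ‖G.discount ^ k * G.payoff i (ω k).1 (ω k).2‖ ∂(G.playLaw μ π) := by
    refine .of_nonneg_of_le (fun k => integral_nonneg fun ω => norm_nonneg _) (fun k => ?_)
      (G.summable_discount_pow.mul_right C)
    refine (integral_mono (hint k).norm (integrable_const (G.discount ^ k * C))
      fun ω => ?_).trans (by simp)
    simp only [norm_mul, norm_pow, Real.norm_of_nonneg G.discount_pos.le]
    exact mul_le_mul_of_nonneg_left (hC ⟨ω k, rfl⟩) (pow_nonneg G.discount_pos.le k)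
  unfold value
  rw [← integral_tsum_of_summable_integral_norm hint hsum]
  simp only [integral_const_mul, G.integral_stage μ π _ fun x => G.payoff i x.1 x.2]
  have h1 : ∀ k : ℕ, G.discount ^ k * ∑ s, μ s * ∑ s', (G.transMatrix π ^ k) s s' *
      policyMean π (fun s a => G.payoff i s a) s' =
      ∑ s', ∑ s, (G.discount ^ k * (G.transMatrix π ^ k) s s') *
        (μ s * policyMean π (G.payoff i) s') := fun k => by
    simp only [Finset.mul_sum]
    rw [Finset.sum_comm]
    exact Finset.sum_congr rfl fun _ _ => Finset.sum_congr rfl fun _ _ => by ring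
  simp only [h1]
  rw [Summable.tsum_finsetSum fun s' _ => summable_sum fun s _ =>
    (G.summable_occupancy π s s').mul_right _]
  refine Finset.sum_congr rfl fun s' _ => ?_
  rw [Summable.tsum_finsetSum fun s _ => (G.summable_occupancy π s s').mul_right _]
  simp only [tsum_mul_right, visits, occupancy, Finset.sum_mul]
  exact Finset.sum_congr rfl fun _ _ => by ring

lemma visits_vertex (s : S) (π : JointPolicy S A) (s' : S) :
    G.visits (stdSimplex.vertex s) π s' = G.occupancy π s s' := by
  simp [visits, Pi.single_apply, ite_mul]

lemma stateValue_eq (i : I) (s : S) (π : JointPolicy S A) :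
    G.stateValue i s π = ∑ s', G.occupancy π s s' * policyMean π (G.payoff i) s' := by
  have h : G.stateValue i s π = G.value i (stdSimplex.vertex s) π := by
    unfold stateValue
    congr!
  rw [h, value_eq_sum_visits]
  simp only [visits_vertex]

lemma value_eq_sum_stateValue (i : I) (μ : stdSimplex ℝ S) (π : JointPolicy S A) :
    G.value i μ π = ∑ s, μ s * G.stateValue i s π := by
  simp only [value_eq_sum_visits, stateValue_eq, visits, Finset.sum_mul, Finset.mul_sum]
  rw [Finset.sum_comm]
  simp only [mul_assoc]

/-- The expected payoff of a stage plus the discounted continuation values `v`. -/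
def bellman (i : I) (v : S → ℝ) (π : JointPolicy S A) (s : S) : ℝ :=
  policyMean π (fun s a => G.payoff i s a + G.discount * ∑ s', G.transition s a s' * v s') s

omit [DecidableEq S] in
lemma bellman_eq (i : I) (v : S → ℝ) (π : JointPolicy S A) (s : S) :
    G.bellman i v π s = policyMean π (G.payoff i) s +
      G.discount * ∑ s', G.transMatrix π s s' * v s' := by
  simp only [bellman, policyMean, transMatrix, mul_add, Finset.sum_add_distrib, Finset.mul_sum,
    Finset.sum_mul]
  congr 1
  rw [Finset.sum_comm]
  exact Finset.sum_congr rfl fun _ _ => Finset.sum_congr rfl fun _ _ => by ring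

/-- The Bellman equation. -/
lemma bellman_stateValue (i : I) (π : JointPolicy S A) (s : S) :
    G.bellman i (fun s' => G.stateValue i s' π) π s = G.stateValue i s π := by
  rw [bellman_eq]
  simp only [stateValue_eq]
  simp_rw [fun s' => G.occupancy_eq_left π s s', add_mul, Finset.sum_add_distrib]
  congr 1
  · simp [Matrix.one_apply]
  · simp only [Finset.mul_sum, Finset.sum_mul]
    rw [Finset.sum_comm]
    exact Finset.sum_congr rfl fun _ _ => Finset.sum_congr rfl fun _ _ => by ring

/-- The value of `π'` exceeds the mean of any function `v` of the initial state by the total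
discounted excess of the Bellman operator of `π'` over `v`: pair `v` with the balance equation. -/
lemma value_sub_eq_sum_visits (i : I) (μ : stdSimplex ℝ S) (v : S → ℝ) (π' : JointPolicy S A) :
    G.value i μ π' - ∑ s, μ s * v s =
      ∑ s, G.visits μ π' s * (G.bellman i v π' s - v s) := by
  have h1 : ∑ s, G.visits μ π' s * v s = ∑ s, μ s * v s +
      ∑ s, G.visits μ π' s * (G.discount * ∑ s', G.transMatrix π' s s' * v s') := by
    simp_rw [fun s => congrArg (· * v s) (G.visits_eq μ π' s), add_mul, Finset.sum_add_distrib]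
    congr 1
    simp only [Finset.mul_sum, Finset.sum_mul]
    rw [Finset.sum_comm]
    exact Finset.sum_congr rfl fun _ _ => Finset.sum_congr rfl fun _ _ => by ring
  simp only [bellman_eq, mul_sub, mul_add, Finset.sum_sub_distrib, Finset.sum_add_distrib, h1,
    value_eq_sum_visits]
  ring

end Value

/-! ### Continuity in the policy profile -/

section Continuity

variable {I S : Type*} {A : I → Type*} [Fintype I] [Fintype S] [∀ i, Fintype (A i)]

omit [Fintype I] [Fintype S] in
lemma continuous_policy_apply (i : I) (s : S) (a : A i) :
    Continuous fun π : JointPolicy S A => π i s a :=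
  (continuous_apply a).comp
    (continuous_subtype_val.comp ((continuous_apply s).comp (continuous_apply i)))

lemma dist_policy_le_iff {π π' : JointPolicy S A} {r : ℝ} (hr : 0 ≤ r) :
    dist π π' ≤ r ↔ ∀ i s a, |π i s a - π' i s a| ≤ r := by
  refine (dist_pi_le_iff hr).trans (forall_congr' fun i => ?_)
  refine (dist_pi_le_iff hr).trans (forall_congr' fun s => ?_)
  exact dist_pi_le_iff (f := (π i s).1) (g := (π' i s).1) hr

variable [DecidableEq I] (G : MarkovGame I S A)

omit [Fintype S] in
lemma continuous_policyMean (f : JointPolicy S A → S → (∀ i, A i) → ℝ) (s : S)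
    (hf : ∀ a, Continuous fun π => f π s a) :
    Continuous fun π : JointPolicy S A => policyMean π (f π) s :=
  continuous_finsetSum _ fun a _ =>
    (continuous_finsetProd _ fun i _ => continuous_policy_apply i s (a i)).mul (hf a)

lemma continuous_occupancy [DecidableEq S] (s s' : S) :
    Continuous fun π : JointPolicy S A => G.occupancy π s s' := by
  refine continuous_tsum (fun k => continuous_const.mul ?_) G.summable_discount_pow
    fun k π => G.norm_occupancy_term_le π s s' k
  have hT : Continuous fun π : JointPolicy S A => G.transMatrix π :=
    continuous_matrix fun s s' => continuous_policyMean _ s fun a => continuous_const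
  exact (hT.pow k).matrix_elem s s'

lemma continuous_visits [DecidableEq S] (μ : stdSimplex ℝ S) (s : S) :
    Continuous fun π : JointPolicy S A => G.visits μ π s :=
  continuous_finsetSum _ fun t _ => continuous_const.mul (G.continuous_occupancy t s)

lemma continuous_stateValue (i : I) (s : S) :
    Continuous fun π : JointPolicy S A => G.stateValue i s π := by
  classical
  simp only [stateValue_eq]
  exact continuous_finsetSum _ fun s' _ => (G.continuous_occupancy s s').mul
    (continuous_policyMean _ s' fun a => continuous_const)

lemma continuous_qValue [∀ i, DecidableEq (A i)] (i : I) (s : S) (a : A i) :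
    Continuous fun π : JointPolicy S A => G.qValue i s a π := by
  refine continuous_finsetSum _ fun a _ => .mul
    (continuous_finsetProd _ fun j _ => continuous_policy_apply j s (a j)) ?_
  exact continuous_const.add (continuous_const.mul (continuous_finsetSum _ fun s' _ =>
    continuous_const.mul (G.continuous_stateValue i s')))

end Continuity

/-! ### Performance differences and one-stage gains -/

section Gain

variable {I S : Type*} {A : I → Type*} [Fintype I] [Fintype S] [∀ i, Fintype (A i)]
  [DecidableEq I] [∀ i, DecidableEq (A i)] (G : MarkovGame I S A)

/-- Averaging `Q` over a one-stage deviation gives the Bellman operator of the deviation. -/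
lemma sum_mul_qValue (i : I) (s : S) (π : JointPolicy S A) (πi' : S → stdSimplex ℝ (A i)) :
    ∑ a, πi' s a * G.qValue i s a π =
      G.bellman i (fun s' => G.stateValue i s' π) (Function.update π i πi') s := by
  unfold qValue bellman policyMean
  rw [← Finset.sum_fiberwise Finset.univ (fun a : ∀ j, A j => a i)]
  refine Finset.sum_congr rfl fun ai _ => ?_
  rw [Finset.mul_sum]
  refine Finset.sum_congr rfl fun a ha => ?_
  have hai : a i = ai := (Finset.mem_filter.1 ha).2
  have hprod : ∏ j, (Function.update π i πi') j s (a j) =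
      πi' s ai * ∏ j ∈ Finset.univ.erase i, π j s (a j) := by
    rw [← Finset.mul_prod_erase Finset.univ _ (Finset.mem_univ i), Function.update_self, hai]
    congr 1
    refine Finset.prod_congr rfl fun j hj => ?_
    rw [Function.update_of_ne (Finset.ne_of_mem_erase hj)]
  rw [hprod]
  ring

/-- The performance difference formula: a unilateral deviation changes the value by the total
discounted one-stage advantages, weighted by the visits of the deviating profile. -/
lemma value_update_sub [DecidableEq S] (i : I) (μ : stdSimplex ℝ S) (π : JointPolicy S A)
    (πi' : S → stdSimplex ℝ (A i)) :
    G.value i μ (Function.update π i πi') - G.value i μ π =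
      ∑ s, G.visits μ (Function.update π i πi') s *
        ∑ a, (πi' s a - π i s a) * G.qValue i s a π := by
  rw [G.value_eq_sum_stateValue i μ π, value_sub_eq_sum_visits]
  refine Finset.sum_congr rfl fun s _ => congrArg _ ?_
  have h := G.sum_mul_qValue i s π (π i)
  rw [Function.update_eq_self, bellman_stateValue] at h
  simp only [sub_mul, Finset.sum_sub_distrib, h, sum_mul_qValue]

/-- The most that player `i` can gain over `π` by deviating in state `s` for one stage. The
supremum is attained on the compact simplex, at the elements of `bestOneStage`. -/
def gain (i : I) (s : S) (π : JointPolicy S A) : ℝ :=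
  ⨆ q : stdSimplex ℝ (A i), ∑ a, (q a - π i s a) * G.qValue i s a π

omit [Fintype I] [Fintype S] [DecidableEq I] [∀ i, DecidableEq (A i)] in
lemma continuous_sum_sub_mul (i : I) (p c : A i → ℝ) :
    Continuous fun q : stdSimplex ℝ (A i) => ∑ a, (q a - p a) * c a :=
  continuous_finsetSum _ fun a _ =>
    (((continuous_apply a).comp continuous_subtype_val).sub continuous_const).mul continuous_const

lemma sum_mul_qValue_le_gain (i : I) (s : S) (π : JointPolicy S A) (q : stdSimplex ℝ (A i)) :
    ∑ a, (q a - π i s a) * G.qValue i s a π ≤ G.gain i s π :=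
  le_ciSup (f := fun q : stdSimplex ℝ (A i) => ∑ a, (q a - π i s a) * G.qValue i s a π)
    (isCompact_range (continuous_sum_sub_mul i _ _)).bddAbove q

lemma gain_nonneg (i : I) (s : S) (π : JointPolicy S A) : 0 ≤ G.gain i s π := by
  simpa using G.sum_mul_qValue_le_gain i s π (π i s)

lemma sum_mul_qValue_eq_gain {i : I} {s : S} {π : JointPolicy S A} {b : stdSimplex ℝ (A i)}
    (hb : b ∈ G.bestOneStage i s π) :
    ∑ a, (b a - π i s a) * G.qValue i s a π = G.gain i s π := by
  have : Nonempty (stdSimplex ℝ (A i)) := ⟨b⟩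
  refine le_antisymm (G.sum_mul_qValue_le_gain i s π b) (ciSup_le fun q => ?_)
  simp only [sub_mul, Finset.sum_sub_distrib]
  exact sub_le_sub_right (hb q) _

lemma bestOneStage_nonempty (i : I) (s : S) (π : JointPolicy S A) :
    (G.bestOneStage i s π).Nonempty := by
  obtain ⟨b, -, hb⟩ := isCompact_univ.exists_isMaxOn ⟨π i s, Set.mem_univ _⟩
    (continuous_sum_sub_mul i 0 fun a => G.qValue i s a π).continuousOn
  exact ⟨b, fun q => by simpa using hb (Set.mem_univ q)⟩

lemma continuous_gain (i : I) (s : S) : Continuous fun π : JointPolicy S A => G.gain i s π := by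
  have h : Continuous (Function.uncurry fun (π : JointPolicy S A) (q : stdSimplex ℝ (A i)) =>
      ∑ a, (q a - π i s a) * G.qValue i s a π) := by
    refine continuous_finsetSum _ fun a _ => .mul (.sub ?_ ?_) ?_
    · exact (continuous_apply a).comp (continuous_subtype_val.comp continuous_snd)
    · exact (continuous_policy_apply i s a).comp continuous_fst
    · exact (G.continuous_qValue i s a).comp continuous_fst
  simpa only [gain, iSup, Set.image_univ] using isCompact_univ.continuous_sSup h

/-- No player has a profitable unilateral deviation from the initial law `μ` only if no one-stage
deviation is profitable in any state: every state is visited with positive weight. -/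
lemma gain_eq_zero {μ : stdSimplex ℝ S} (hμ : ∀ s, 0 < μ s) {π : JointPolicy S A}
    (h : ∀ i (πi' : S → stdSimplex ℝ (A i)),
      G.value i μ (Function.update π i πi') ≤ G.value i μ π) (i : I) (s : S) :
    G.gain i s π = 0 := by
  classical
  choose b hb using fun s => G.bestOneStage_nonempty i s π
  have h1 := G.value_update_sub i μ π b
  simp only [G.sum_mul_qValue_eq_gain (hb _)] at h1
  have hpos : ∀ t, 0 < G.visits μ (Function.update π i b) t := fun t =>
    (hμ t).trans_le (G.le_visits μ _ t)
  have h0 : ∀ t ∈ Finset.univ, 0 ≤ G.visits μ (Function.update π i b) t * G.gain i t π :=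
    fun t _ => mul_nonneg (hpos t).le (G.gain_nonneg i t π)
  have h2 := (Finset.sum_eq_zero_iff_of_nonneg h0).1
    (le_antisymm (h1 ▸ sub_nonpos.2 (h i b)) (Finset.sum_nonneg h0)) s (Finset.mem_univ s)
  exact (mul_eq_zero.1 h2).resolve_left (hpos s).ne'

lemma isNash_of_gain_eq_zero {π : JointPolicy S A} (h : ∀ i s, G.gain i s π = 0) :
    G.IsNash π := by
  classical
  intro i πi' μ
  rw [← sub_nonpos, value_update_sub]
  exact Finset.sum_nonpos fun s _ => mul_nonpos_of_nonneg_of_nonpos (G.visits_nonneg _ _ _)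
    ((G.sum_mul_qValue_le_gain i s π (πi' s)).trans (h i s).le)

/-- The total of the one-stage gains of all players in all states, weighted by the discounted
number of visits. It vanishes exactly at the Nash equilibria and controls the speed of the
potential along best-response dynamics. -/
def totalGain [DecidableEq S] (μ : stdSimplex ℝ S) (π : JointPolicy S A) : ℝ :=
  ∑ i, ∑ s, G.visits μ π s * G.gain i s π

variable [DecidableEq S]

lemma totalGain_nonneg (μ : stdSimplex ℝ S) (π : JointPolicy S A) : 0 ≤ G.totalGain μ π :=
  Finset.sum_nonneg fun i _ => Finset.sum_nonneg fun s _ =>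
    mul_nonneg (G.visits_nonneg μ π s) (G.gain_nonneg i s π)

lemma continuous_totalGain (μ : stdSimplex ℝ S) : Continuous (G.totalGain μ) :=
  continuous_finsetSum _ fun i _ => continuous_finsetSum _ fun s _ =>
    (G.continuous_visits μ s).mul (G.continuous_gain i s)

lemma totalGain_eq_zero_iff {μ : stdSimplex ℝ S} (hμ : ∀ s, 0 < μ s) (π : JointPolicy S A) :
    G.totalGain μ π = 0 ↔ G.IsNash π := by
  have h0 : ∀ i s, 0 ≤ G.visits μ π s * G.gain i s π := fun i s =>
    mul_nonneg (G.visits_nonneg μ π s) (G.gain_nonneg i s π)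
  constructor
  · intro h
    refine G.isNash_of_gain_eq_zero fun i s => ?_
    have h1 := (Finset.sum_eq_zero_iff_of_nonneg fun i _ => Finset.sum_nonneg fun s _ =>
      h0 i s).1 h i (Finset.mem_univ i)
    have h2 := (Finset.sum_eq_zero_iff_of_nonneg fun s _ => h0 i s).1 h1 s (Finset.mem_univ s)
    exact (mul_eq_zero.1 h2).resolve_left ((hμ s).trans_le (G.le_visits μ π s)).ne'
  · intro h
    exact Finset.sum_eq_zero fun i _ => Finset.sum_eq_zero fun s _ => by
      rw [G.gain_eq_zero hμ (fun i πi' => h i πi' μ), mul_zero]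

end Gain

/-! ### The averaged potential -/

section Potential

variable {I S : Type*} {A : I → Type*} [Fintype I] [Fintype S] [∀ i, Fintype (A i)]
  [DecidableEq I] [∀ i, DecidableEq (A i)] {G : MarkovGame I S A} {Φ : S → JointPolicy S A → ℝ}

omit [∀ i, DecidableEq (A i)] in
lemma IsPotential.avgPotential_update_sub (hΦ : G.IsPotential Φ) (μ : stdSimplex ℝ S) (i : I)
    (π : JointPolicy S A) (πi' : S → stdSimplex ℝ (A i)) :
    avgPotential Φ μ (Function.update π i πi') - avgPotential Φ μ π =
      G.value i μ (Function.update π i πi') - G.value i μ π := by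
  classical
  simp only [avgPotential, value_eq_sum_stateValue, ← Finset.sum_sub_distrib, ← mul_sub,
    hΦ _ i π πi']

variable [DecidableEq S]

/-- Switching the players from `π` to `π'` one at a time writes the increment of the averaged
potential as a combination of the increments of the policies. The coefficients are continuous,
and on the diagonal they are the policy gradients `visits * Q`. -/
lemma IsPotential.exists_weights (hΦ : G.IsPotential Φ) (μ : stdSimplex ℝ S) :
    ∃ W : ∀ i : I, S → A i → JointPolicy S A × JointPolicy S A → ℝ,
      (∀ i s a, Continuous (W i s a)) ∧
      (∀ i s a π, W i s a (π, π) = G.visits μ π s * G.qValue i s a π) ∧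
      ∀ π π', avgPotential Φ μ π' - avgPotential Φ μ π =
        ∑ i, ∑ s, ∑ a, W i s a (π, π') * (π' i s a - π i s a) := by
  suffices H : ∀ T : Finset I, ∃ W : ∀ i : I, S → A i → JointPolicy S A × JointPolicy S A → ℝ,
      (∀ i s a, Continuous (W i s a)) ∧
      (∀ i s a π, W i s a (π, π) = G.visits μ π s * G.qValue i s a π) ∧
      ∀ π π', avgPotential Φ μ (T.piecewise π' π) - avgPotential Φ μ π =
        ∑ i ∈ T, ∑ s, ∑ a, W i s a (π, π') * (π' i s a - π i s a) by
    simpa using H Finset.univ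
  have hcont : ∀ T : Finset I, Continuous
      fun p : JointPolicy S A × JointPolicy S A => (T.piecewise p.2 p.1 : JointPolicy S A) := by
    intro T
    refine continuous_pi fun j => ?_
    by_cases hj : j ∈ T
    · simp only [hj, Finset.piecewise_eq_of_mem]
      exact (continuous_apply j).comp (Y := JointPolicy S A) continuous_snd
    · simp only [hj, not_false_eq_true, Finset.piecewise_eq_of_notMem]
      exact (continuous_apply j).comp (Y := JointPolicy S A) continuous_fst
  have hself : ∀ (T : Finset I) (π : JointPolicy S A), T.piecewise π π = π := fun T π =>
    funext fun j => by simp [Finset.piecewise]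
  intro T
  induction T using Finset.induction_on with
  | empty =>
    refine ⟨fun i s a p => G.visits μ p.1 s * G.qValue i s a p.1, fun i s a => ?_,
      fun _ _ _ _ => rfl, fun π π' => by simp⟩
    exact ((G.continuous_visits μ s).comp continuous_fst).mul
      ((G.continuous_qValue i s a).comp continuous_fst)
  | insert i T hi ih =>
    obtain ⟨W, hW, hdiag, hsum⟩ := ih
    -- the players in `T` have already switched when `i` switches from `π` to `π'`
    refine ⟨Function.update W i fun s a p => G.visits μ ((insert i T).piecewise p.2 p.1) s *
      G.qValue i s a (T.piecewise p.2 p.1), fun j s a => ?_, fun j s a π => ?_, fun π π' => ?_⟩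
    · by_cases hj : j = i
      · subst hj
        rw [Function.update_self]
        exact ((G.continuous_visits μ s).comp (hcont _)).mul
          ((G.continuous_qValue j s a).comp (hcont T))
      · rw [Function.update_of_ne hj]
        exact hW j s a
    · by_cases hj : j = i
      · subst hj
        simp only [Function.update_self, hself]
      · rw [Function.update_of_ne hj]
        exact hdiag j s a π
    · rw [Finset.sum_insert hi, Function.update_self,
        ← sub_add_sub_cancel _ (avgPotential Φ μ (T.piecewise π' π)), hsum]
      congr 1
      · rw [Finset.piecewise_insert, hΦ.avgPotential_update_sub, value_update_sub]
        refine Finset.sum_congr rfl fun s _ => ?_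
        rw [Finset.mul_sum]
        refine Finset.sum_congr rfl fun a _ => ?_
        rw [Finset.piecewise_eq_of_notMem T _ _ hi]
        ring
      · refine Finset.sum_congr rfl fun j hj => ?_
        rw [Function.update_of_ne (ne_of_mem_of_not_mem hj hi)]

omit [DecidableEq S] [∀ i, DecidableEq (A i)] in
lemma IsPotential.exists_lipschitzWith (hΦ : G.IsPotential Φ) (μ : stdSimplex ℝ S) :
    ∃ K, LipschitzWith K (avgPotential Φ μ) := by
  classical
  obtain ⟨W, hW, -, hsum⟩ := hΦ.exists_weights μ
  choose C hC using fun i s a =>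
    isCompact_univ.exists_bound_of_continuousOn (hW i s a).continuousOn
  refine ⟨_, LipschitzWith.of_dist_le' (K := ∑ i, ∑ s, ∑ a, C i s a) fun π' π => ?_⟩
  rw [Real.dist_eq, hsum]
  simp only [Finset.sum_mul]
  refine (Finset.abs_sum_le_sum_abs _ _).trans (Finset.sum_le_sum fun i _ => ?_)
  refine (Finset.abs_sum_le_sum_abs _ _).trans (Finset.sum_le_sum fun s _ => ?_)
  refine (Finset.abs_sum_le_sum_abs _ _).trans (Finset.sum_le_sum fun a _ => ?_)
  have h := hC i s a (π, π') (Set.mem_univ _)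
  rw [abs_mul]
  exact mul_le_mul h ((dist_policy_le_iff dist_nonneg).1 le_rfl i s a) (abs_nonneg _)
    ((norm_nonneg _).trans h)

omit [DecidableEq S] [∀ i, DecidableEq (A i)] in
lemma IsPotential.exists_isMax (hΦ : G.IsPotential Φ) (μ : stdSimplex ℝ S) (π₀ : JointPolicy S A) :
    ∃ π, ∀ π', avgPotential Φ μ π' ≤ avgPotential Φ μ π := by
  obtain ⟨K, hK⟩ := hΦ.exists_lipschitzWith μ
  obtain ⟨π, -, hπ⟩ :=
    isCompact_univ.exists_isMaxOn ⟨π₀, Set.mem_univ _⟩ hK.continuous.continuousOn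
  exact ⟨π, fun π' => hπ (Set.mem_univ π')⟩

omit [DecidableEq S] in
lemma IsPotential.isNash_of_isMax (hΦ : G.IsPotential Φ) {μ : stdSimplex ℝ S}
    (hμ : ∀ s, 0 < μ s) {π : JointPolicy S A}
    (hπ : ∀ π', avgPotential Φ μ π' ≤ avgPotential Φ μ π) : G.IsNash π :=
  G.isNash_of_gain_eq_zero <| G.gain_eq_zero hμ fun i πi' => by
    have h := hΦ.avgPotential_update_sub μ i π πi'
    linarith [hπ (Function.update π i πi')]

end Potential

end

end MarkovGame

/-! ### One-variable calculus -/

/-- Integrating an almost everywhere bound on the derivative of an absolutely continuous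
function. -/
lemma AbsolutelyContinuousOnInterval.sub_le_of_ae {f : ℝ → ℝ} {a b K : ℝ} (ha : 0 ≤ a)
    (hab : a ≤ b) (hf : AbsolutelyContinuousOnInterval f a b)
    (h : ∀ᵐ t ∂(volume.restrict (Set.Ici (0 : ℝ))), t ∈ Set.Icc a b →
      ∃ d, d ≤ K ∧ HasDerivWithinAt f d (Set.Ici 0) t) :
    f b - f a ≤ K * (b - a) := by
  have h1 : deriv f ≤ᵐ[volume.restrict (Set.Icc a b)] fun _ => K := by
    rw [← restrict_Ioo_eq_restrict_Icc]
    have h2 := ae_restrict_of_ae_restrict_of_subset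
      (fun t (ht : t ∈ Set.Ioo a b) => Set.mem_Ici.2 (ha.trans ht.1.le)) h
    filter_upwards [h2, ae_restrict_mem measurableSet_Ioo] with t ht htab
    obtain ⟨d, hd, hdt⟩ := ht ⟨htab.1.le, htab.2.le⟩
    rwa [(hdt.hasDerivAt (Ici_mem_nhds (ha.trans_lt htab.1))).deriv]
  have h3 := intervalIntegral.integral_mono_ae_restrict hab hf.intervalIntegrable_deriv
    intervalIntegrable_const h1
  rw [hf.integral_deriv_eq_sub, intervalIntegral.integral_const, smul_eq_mul] at h3
  linarith

lemma AbsolutelyContinuousOnInterval.le_sub_of_ae {f : ℝ → ℝ} {a b K : ℝ} (ha : 0 ≤ a)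
    (hab : a ≤ b) (hf : AbsolutelyContinuousOnInterval f a b)
    (h : ∀ᵐ t ∂(volume.restrict (Set.Ici (0 : ℝ))), t ∈ Set.Icc a b →
      ∃ d, K ≤ d ∧ HasDerivWithinAt f d (Set.Ici 0) t) :
    K * (b - a) ≤ f b - f a := by
  have h1 := hf.neg.sub_le_of_ae (K := -K) ha hab (h.mono fun t ht htab => by
    obtain ⟨d, hd, hdt⟩ := ht htab
    exact ⟨-d, neg_le_neg hd, hdt.neg⟩)
  simp only [Pi.neg_apply] at h1
  linarith

/-- A product with a factor that vanishes at `τ` is differentiable at `τ` as soon as that factor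
is and the other one is continuous there. -/
lemma HasDerivWithinAt.continuousWithinAt_mul_sub {f h : ℝ → ℝ} {f' τ : ℝ} {s : Set ℝ}
    (hf : HasDerivWithinAt f f' s τ) (hh : ContinuousWithinAt h s τ) :
    HasDerivWithinAt (fun t => h t * (f t - f τ)) (h τ * f') s τ := by
  rw [hasDerivWithinAt_iff_tendsto_slope] at hf ⊢
  refine (Tendsto.mul (hh.mono_left (nhdsWithin_mono τ Set.sdiff_subset)) hf).congr fun t => ?_
  simp only [slope_def_field, sub_self, mul_zero, sub_zero]
  ring

/-- If the increments of `f` from `τ` on are at least those of slope `c` for every lower bound `c`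
of `g`, then the right derivative of `f` at `τ` is at least `g τ`. -/
lemma le_hasDerivWithinAt_of_growth {f g : ℝ → ℝ} {d τ : ℝ} (hτ : 0 ≤ τ)
    (hd : HasDerivWithinAt f d (Set.Ici 0) τ) (hg : ContinuousWithinAt g (Set.Ici 0) τ)
    (h : ∀ u c, τ ≤ u → (∀ t ∈ Set.Icc τ u, c ≤ g t) → c * (u - τ) ≤ f u - f τ) :
    g τ ≤ d := by
  have hsub : Set.Ici τ ⊆ Set.Ici 0 := Set.Ici_subset_Ici.2 hτ
  have hd' := hasDerivWithinAt_iff_tendsto_slope.1 (hd.mono hsub)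
  rw [Set.Ici_sdiff_left] at hd'
  refine le_of_forall_lt_imp_le_of_dense fun c hc => ge_of_tendsto hd' ?_
  obtain ⟨u, hu, hsubu⟩ := mem_nhdsGE_iff_exists_Ico_subset.1
    ((hg.mono hsub).eventually (lt_mem_nhds hc))
  filter_upwards [Ioo_mem_nhdsGT hu] with x hx
  rw [slope_def_field, le_div_iff₀ (sub_pos.2 hx.1)]
  exact h x c hx.1.le fun t ht => le_of_lt (hsubu ⟨ht.1, ht.2.trans_lt hx.2⟩)

namespace MarkovGame

noncomputable section

/-! ### The potential along solutions -/

section Solution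

variable {I S : Type*} {A : I → Type*} [Fintype I] [Fintype S] [∀ i, Fintype (A i)]
  [DecidableEq I] [∀ i, DecidableEq (A i)] {G : MarkovGame I S A} {Φ : S → JointPolicy S A → ℝ}
  {γ : I → S → ℝ → ℝ} {η Γ : ℝ} {ϖ : ℝ → JointPolicy S A}

/-- Solutions are Lipschitz: best responses and policies have entries in `[0, 1]`, so that `Γ`
bounds the speed of each coordinate. -/
lemma IsSolution.lipschitzOnWith (hϖ : G.IsSolution γ ϖ) (hη : 0 < η) (hΓ : 0 < Γ)
    (hγ : ∀ i s τ, 0 ≤ τ → γ i s τ ∈ Set.Icc η Γ) :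
    LipschitzOnWith Γ.toNNReal ϖ (Set.Ici 0) := by
  refine LipschitzOnWith.of_dist_le' fun t ht u hu => ?_
  wlog hut : u ≤ t generalizing t u
  · rw [dist_comm, dist_comm t]
    exact this u hu t ht (le_of_not_ge hut)
  rw [dist_policy_le_iff (mul_nonneg hΓ.le dist_nonneg), Real.dist_eq,
    abs_of_nonneg (sub_nonneg.2 hut)]
  intro i s a
  have hac := (hϖ.absCont i s a t ht).mono (c := u) (d := t) (by
    rw [Set.uIcc_of_le hut, Set.uIcc_of_le (Set.mem_Ici.1 ht)]
    exact Set.Icc_subset_Icc_left hu)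
  have hder : ∀ᵐ τ ∂(volume.restrict (Set.Ici (0 : ℝ))), τ ∈ Set.Icc u t →
      ∃ d, (-Γ ≤ d ∧ d ≤ Γ) ∧ HasDerivWithinAt (fun t => ϖ t i s a) d (Set.Ici 0) τ := by
    filter_upwards [hϖ.inclusion] with τ hτ hτut
    obtain ⟨b, -, hb⟩ := hτ i s
    refine ⟨_, ?_, hb a⟩
    have h1 := hγ i s τ ((Set.mem_Ici.1 hu).trans hτut.1)
    have h2 := stdSimplex.zero_le b a
    have h3 := stdSimplex.le_one b a
    have h4 := stdSimplex.zero_le (ϖ τ i s) a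
    have h5 := stdSimplex.le_one (ϖ τ i s) a
    rw [← abs_le, abs_mul, abs_of_nonneg (hη.le.trans h1.1)]
    exact (mul_le_of_le_one_right (hη.le.trans h1.1)
      (abs_le.2 ⟨by linarith, by linarith⟩)).trans h1.2
  rw [abs_le, ← neg_mul]
  exact ⟨hac.le_sub_of_ae hu hut (hder.mono fun τ h hτ =>
      (h hτ).imp fun d hd => ⟨hd.1.1, hd.2⟩),
    hac.sub_le_of_ae hu hut (hder.mono fun τ h hτ => (h hτ).imp fun d hd => ⟨hd.1.2, hd.2⟩)⟩

variable [DecidableEq S]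

/-- Along the dynamics the averaged potential grows by the one-stage gains, weighted by the visits
and the speeds. -/
lemma IsPotential.hasDerivWithinAt_avgPotential (hΦ : G.IsPotential Φ) (μ : stdSimplex ℝ S)
    {τ : ℝ} (hc : ContinuousWithinAt ϖ (Set.Ici 0) τ) (h : G.InclusionAt γ ϖ τ) :
    HasDerivWithinAt (fun t => avgPotential Φ μ (ϖ t))
      (∑ i, ∑ s, γ i s τ * (G.visits μ (ϖ τ) s * G.gain i s (ϖ τ))) (Set.Ici 0) τ := by
  obtain ⟨W, hW, hdiag, hsum⟩ := hΦ.exists_weights μ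
  choose b hb hder using h
  have h1 : HasDerivWithinAt (fun t => ∑ i, ∑ s, ∑ a,
        W i s a (ϖ τ, ϖ t) * (ϖ t i s a - ϖ τ i s a))
      (∑ i, ∑ s, ∑ a, W i s a (ϖ τ, ϖ τ) * (γ i s τ * (b i s a - ϖ τ i s a)))
      (Set.Ici 0) τ :=
    HasDerivWithinAt.fun_sum fun i _ => .fun_sum fun s _ => .fun_sum fun a _ =>
      (hder i s a).continuousWithinAt_mul_sub
        ((hW i s a).continuousAt.comp_continuousWithinAt (continuousWithinAt_const.prodMk hc))
  have h2 : ∑ i, ∑ s, ∑ a, W i s a (ϖ τ, ϖ τ) * (γ i s τ * (b i s a - ϖ τ i s a)) =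
      ∑ i, ∑ s, γ i s τ * (G.visits μ (ϖ τ) s * G.gain i s (ϖ τ)) := by
    refine Finset.sum_congr rfl fun i _ => Finset.sum_congr rfl fun s _ => ?_
    rw [← G.sum_mul_qValue_eq_gain (hb i s), Finset.mul_sum, Finset.mul_sum]
    refine Finset.sum_congr rfl fun a _ => ?_
    rw [hdiag]
    ring
  rw [h2] at h1
  simp only [← hsum] at h1
  exact (hasDerivWithinAt_sub_const_iff _).1 h1

variable (hΦ : G.IsPotential Φ) (hϖ : G.IsSolution γ ϖ) (hη : 0 < η) (hΓ : 0 < Γ)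
  (hγ : ∀ i s τ, 0 ≤ τ → γ i s τ ∈ Set.Icc η Γ) (μ : stdSimplex ℝ S)

include hΦ hϖ hη hΓ hγ

omit [DecidableEq S] in
lemma IsSolution.absolutelyContinuous_avgPotential {a b : ℝ} (ha : 0 ≤ a) (hab : a ≤ b) :
    AbsolutelyContinuousOnInterval (fun t => avgPotential Φ μ (ϖ t)) a b := by
  obtain ⟨K, hK⟩ := hΦ.exists_lipschitzWith μ
  refine LipschitzOnWith.absolutelyContinuousOnInterval
    (hK.comp_lipschitzOnWith ((hϖ.lipschitzOnWith hη hΓ hγ).mono ?_))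
  rw [Set.uIcc_of_le hab]
  exact fun t ht => ha.trans ht.1

lemma IsSolution.ae_hasDerivWithinAt_avgPotential :
    ∀ᵐ t ∂(volume.restrict (Set.Ici (0 : ℝ))), ∃ d,
      (η * G.totalGain μ (ϖ t) ≤ d ∧ d ≤ Γ * G.totalGain μ (ϖ t)) ∧
      HasDerivWithinAt (fun t => avgPotential Φ μ (ϖ t)) d (Set.Ici 0) t := by
  filter_upwards [hϖ.inclusion, ae_restrict_mem measurableSet_Ici] with t ht ht0
  refine ⟨_, ?_, hΦ.hasDerivWithinAt_avgPotential μ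
    ((hϖ.lipschitzOnWith hη hΓ hγ).continuousOn t ht0) ht⟩
  have h0 : ∀ i s, 0 ≤ G.visits μ (ϖ t) s * G.gain i s (ϖ t) := fun i s =>
    mul_nonneg (G.visits_nonneg _ _ _) (G.gain_nonneg _ _ _)
  simp only [totalGain, Finset.mul_sum]
  exact ⟨Finset.sum_le_sum fun i _ => Finset.sum_le_sum fun s _ =>
      mul_le_mul_of_nonneg_right (hγ i s t ht0).1 (h0 i s),
    Finset.sum_le_sum fun i _ => Finset.sum_le_sum fun s _ =>
      mul_le_mul_of_nonneg_right (hγ i s t ht0).2 (h0 i s)⟩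

lemma IsSolution.le_avgPotential_sub {a b c : ℝ} (ha : 0 ≤ a) (hab : a ≤ b)
    (hc : ∀ t ∈ Set.Icc a b, c ≤ η * G.totalGain μ (ϖ t)) :
    c * (b - a) ≤ avgPotential Φ μ (ϖ b) - avgPotential Φ μ (ϖ a) :=
  (hϖ.absolutelyContinuous_avgPotential hΦ hη hΓ hγ μ ha hab).le_sub_of_ae ha hab
    ((hϖ.ae_hasDerivWithinAt_avgPotential hΦ hη hΓ hγ μ).mono fun t ⟨d, hd, hdt⟩ ht =>
      ⟨d, (hc t ht).trans hd.1, hdt⟩)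

lemma IsSolution.avgPotential_sub_le {a b c : ℝ} (ha : 0 ≤ a) (hab : a ≤ b)
    (hc : ∀ t ∈ Set.Icc a b, Γ * G.totalGain μ (ϖ t) ≤ c) :
    avgPotential Φ μ (ϖ b) - avgPotential Φ μ (ϖ a) ≤ c * (b - a) :=
  (hϖ.absolutelyContinuous_avgPotential hΦ hη hΓ hγ μ ha hab).sub_le_of_ae ha hab
    ((hϖ.ae_hasDerivWithinAt_avgPotential hΦ hη hΓ hγ μ).mono fun t ⟨d, hd, hdt⟩ ht =>
      ⟨d, hd.2.trans (hc t ht), hdt⟩)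

omit [DecidableEq S] in
lemma IsSolution.monotoneOn_avgPotential :
    MonotoneOn (fun t => avgPotential Φ μ (ϖ t)) (Set.Ici 0) := by
  classical
  intro a ha b _ hab
  have h := hϖ.le_avgPotential_sub hΦ hη hΓ hγ μ (c := 0) ha hab fun t _ =>
    mul_nonneg hη.le (G.totalGain_nonneg μ _)
  simpa using h

/-- Wherever the potential is differentiable along a solution, even if the solution is not, its
derivative lies between `η` and `Γ` times the total gain. -/
lemma IsSolution.deriv_avgPotential_mem {τ d : ℝ} (hτ : 0 ≤ τ)
    (hd : HasDerivWithinAt (fun t => avgPotential Φ μ (ϖ t)) d (Set.Ici 0) τ) :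
    η * G.totalGain μ (ϖ τ) ≤ d ∧ d ≤ Γ * G.totalGain μ (ϖ τ) := by
  have hcont : ContinuousWithinAt (fun t => G.totalGain μ (ϖ t)) (Set.Ici 0) τ :=
    (G.continuous_totalGain μ).continuousAt.comp_continuousWithinAt
      ((hϖ.lipschitzOnWith hη hΓ hγ).continuousOn τ hτ)
  constructor
  · exact le_hasDerivWithinAt_of_growth (g := fun t => η * G.totalGain μ (ϖ t)) hτ hd
      (continuousWithinAt_const.mul hcont) fun u c hu hc =>
        hϖ.le_avgPotential_sub hΦ hη hΓ hγ μ hτ hu hc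
  · refine neg_le_neg_iff.1 (le_hasDerivWithinAt_of_growth
      (g := fun t => -(Γ * G.totalGain μ (ϖ t))) hτ hd.neg
      (continuousWithinAt_const.mul hcont).neg fun u c hu hc => ?_)
    have h := hϖ.avgPotential_sub_le hΦ hη hΓ hγ μ (c := -c) hτ hu fun t ht =>
      le_neg.1 (hc t ht)
    simp only [Pi.neg_apply]
    linarith

omit [DecidableEq S] in
/-- While the solution is at distance at least `ε / 2` from the equilibria, the potential grows at
a rate bounded away from zero. As the solution is Lipschitz, being at distance `ε` at one time
entails a fixed later increase of the potential, which near its supremum is impossible. -/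
lemma IsSolution.tendsto_infDist_isNash (hμ : ∀ s, 0 < μ s) :
    Tendsto (fun τ => Metric.infDist (ϖ τ) {π | G.IsNash π}) atTop (𝓝 0) := by
  classical
  obtain ⟨πmax, hmax⟩ := hΦ.exists_isMax μ (ϖ 0)
  refine Metric.tendsto_atTop.2 fun ε hε => ?_
  have hK : IsCompact {π : JointPolicy S A | ε / 2 ≤ Metric.infDist π {π | G.IsNash π}} :=
    (isClosed_le continuous_const (Metric.continuous_infDist_pt _)).isCompact
  obtain ⟨m, hm, hmK⟩ := hK.exists_forall_le' (G.continuous_totalGain μ).continuousOn (a := 0)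
    fun π hπ => (G.totalGain_nonneg μ π).lt_of_ne' fun h0 => by
      have hN : π ∈ {π | G.IsNash π} := (G.totalGain_eq_zero_iff hμ π).1 h0
      rw [Set.mem_ofPred_eq, Metric.infDist_zero_of_mem hN] at hπ
      linarith
  -- within time `r` the solution moves by at most `ε / 2`
  set r := ε / 2 / Γ with hr
  have hr0 : 0 < r := by positivity
  have hbdd : BddAbove ((fun t => avgPotential Φ μ (ϖ t)) '' Set.Ici 0) :=
    ⟨avgPotential Φ μ πmax, by rintro _ ⟨t, -, rfl⟩; exact hmax _⟩
  obtain ⟨_, ⟨T, hT0, rfl⟩, hT⟩ := exists_lt_of_lt_csSup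
    (Set.image_nonempty.2 ⟨0, Set.self_mem_Ici⟩)
    (sub_lt_self (sSup ((fun t => avgPotential Φ μ (ϖ t)) '' Set.Ici 0))
      (mul_pos (mul_pos hη hm) hr0))
  refine ⟨T, fun t ht => ?_⟩
  have ht0 : 0 ≤ t := (Set.mem_Ici.1 hT0).trans ht
  rw [Real.dist_0_eq_abs, abs_of_nonneg Metric.infDist_nonneg]
  by_contra! hfar
  have hgrow := hϖ.le_avgPotential_sub hΦ hη hΓ hγ μ (a := t) (b := t + r) (c := η * m) ht0
    (by linarith) fun u hu => by
      refine mul_le_mul_of_nonneg_left (hmK _ ?_) hη.le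
      have h1 := Metric.infDist_le_infDist_add_dist (s := {π | G.IsNash π}) (x := ϖ t) (y := ϖ u)
      have h2 := (hϖ.lipschitzOnWith hη hΓ hγ).dist_le_mul u (ht0.trans hu.1) t ht0
      rw [Real.coe_toNNReal _ hΓ.le, dist_comm, Real.dist_eq,
        abs_of_nonneg (sub_nonneg.2 hu.1)] at h2
      have h3 : Γ * (u - t) ≤ Γ * r := mul_le_mul_of_nonneg_left (by linarith [hu.2]) hΓ.le
      have h4 : Γ * r = ε / 2 := by rw [hr]; field_simp
      change ε / 2 ≤ _
      linarith
  have h5 := le_csSup hbdd ⟨t + r, Set.mem_Ici.2 (by linarith), rfl⟩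
  have h6 := hϖ.monotoneOn_avgPotential hΦ hη hΓ hγ μ hT0 ht0 ht
  simp only [add_sub_cancel_left] at hgrow h5 h6 hT
  linarith

end Solution

end

end MarkovGame

/-! ### Lyapunov function and convergence to equilibrium -/

theorem mainTheorem4 {I S : Type*} {A : I → Type*} [Fintype I] [Fintype S]
    [∀ i, Fintype (A i)] [DecidableEq I] [∀ i, DecidableEq (A i)]
    (G : MarkovGame I S A) (Φ : S → JointPolicy S A → ℝ) (hΦ : G.IsPotential Φ)
    (μ : stdSimplex ℝ S) (hμ : ∀ s, 0 < μ s)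
    (γ : I → S → ℝ → ℝ) (η Γ : ℝ) (hη : 0 < η)
    (hγ : ∀ i s τ, 0 ≤ τ → γ i s τ ∈ Set.Icc η Γ)
    (ϖ : ℝ → JointPolicy S A) (hϖ : G.IsSolution γ ϖ) :
    -- the maximum in the definition of `φ` is attained
    (∃ π, ∀ π', avgPotential Φ μ π' ≤ avgPotential Φ μ π) ∧
    AntitoneOn (potentialGap Φ μ ϖ) (Set.Ici 0) ∧
    -- `φ` is differentiable wherever the inclusion holds, hence at almost every time
    (∀ τ, 0 ≤ τ → G.InclusionAt γ ϖ τ →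
      DifferentiableWithinAt ℝ (potentialGap Φ μ ϖ) (Set.Ici 0) τ) ∧
    -- the sign of the derivative, wherever it exists
    (∀ τ d, 0 ≤ τ → HasDerivWithinAt (potentialGap Φ μ ϖ) d (Set.Ici 0) τ →
      d ≤ 0 ∧ (¬ G.IsNash (ϖ τ) → d < 0) ∧ (G.IsNash (ϖ τ) → d = 0)) ∧
    -- convergence to the (nonempty) set of Nash equilibria
    {π | G.IsNash π}.Nonempty ∧
    Tendsto (fun τ => Metric.infDist (ϖ τ) {π | G.IsNash π}) atTop (𝓝 0) := by
  classical
  -- without players the bound `γ ≤ Γ` is void, and `Γ` may be negative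
  have hΓ : 0 < max Γ η := lt_max_of_lt_right hη
  replace hγ : ∀ i s τ, 0 ≤ τ → γ i s τ ∈ Set.Icc η (max Γ η) := fun i s τ hτ =>
    ⟨(hγ i s τ hτ).1, (hγ i s τ hτ).2.trans (le_max_left _ _)⟩
  obtain ⟨πmax, hmax⟩ := hΦ.exists_isMax μ (ϖ 0)
  refine ⟨⟨πmax, hmax⟩, fun a ha b hb hab => ?_, fun τ hτ h => ?_, fun τ d hτ hd => ?_,
    ⟨πmax, hΦ.isNash_of_isMax hμ hmax⟩, hϖ.tendsto_infDist_isNash hΦ hη hΓ hγ μ hμ⟩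
  · exact sub_le_sub_left (hϖ.monotoneOn_avgPotential hΦ hη hΓ hγ μ ha hb hab) _
  · exact ((hΦ.hasDerivWithinAt_avgPotential μ
      ((hϖ.lipschitzOnWith hη hΓ hγ).continuousOn τ hτ) h).const_sub _).differentiableWithinAt
  · have hd' : HasDerivWithinAt (fun t => avgPotential Φ μ (ϖ t)) (-d) (Set.Ici 0) τ := by
      simpa [potentialGap] using hd.const_sub (⨆ π : JointPolicy S A, avgPotential Φ μ π)
    obtain ⟨h1, h2⟩ := hϖ.deriv_avgPotential_mem hΦ hη hΓ hγ μ hτ hd'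
    have h0 := mul_nonneg hη.le (G.totalGain_nonneg μ (ϖ τ))
    refine ⟨by linarith, fun hN => ?_, fun hN => ?_⟩
    · have hpos := mul_pos hη ((G.totalGain_nonneg μ (ϖ τ)).lt_of_ne'
        (mt (G.totalGain_eq_zero_iff hμ _).1 hN))
      linarith
    · rw [(G.totalGain_eq_zero_iff hμ _).2 hN, mul_zero] at h1 h2
      linarith
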